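/- There is an absolute constant $C>0$ such that the following holds. Let $n\ge 1$ and let $P$ be a probability distribution on $\mathbb{R}^n$ that is supported (almost surely) in the centered Euclidean ball of radius $\sqrt m$, where $m\ge 0$. Let $\Sigma=\mathbb{E}\,X\otimes X=(\mathbb{E}X_jX_k)_{j,k\le n}$ with $X\sim P$ be its second moment matrix, which is the covariance matrix of $P$ if $P$ is centered (centering is not required), and assume $\Sigma\ne 0$. Let $\varepsilon\in(0,1)$ and $t\ge 1$, and let $N$ be a positive integer with $$N\ \ge\ C\,(t/\varepsilon)^2\,\|\Sigma\|^{-1}\,m\log n .$$ If $X_1,\dots,X_N$ are independent random vectors with distribution $P$ and $\Sigma_N=\frac1N\sum_{i=1}^N X_i\otimes X_i$ is the sample covariance matrix, then with probability at least $1-n^{-t^2}$, $$\|\Sigma_N-\Sigma\|\ \le\ \varepsilon\,\|\Sigma\| .$$ Here $\|\cdot\|$ is the operator norm $\ell_2^n\to\ell_2^n$ and $\log$ is the natural logarithm. -/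

import Mathlib

open MeasureTheory ProbabilityTheory
open scoped Matrix.Norms.L2Operator

/-- The matrix `Σ = 𝔼 X ⊗ X` of a random vector `X` in `ℝⁿ` with law `P`, whose `(j, k)` entry is
`𝔼 X_j X_k`. It is the covariance matrix of `X` when `X` is centered. -/
noncomputable def secondMomentMatrix {n : ℕ} (P : Measure (EuclideanSpace ℝ (Fin n))) :
    Matrix (Fin n) (Fin n) ℝ :=
  Matrix.of fun j k => ∫ x, x j * x k ∂P

/-- The sample covariance matrix `Σ_N = (1/N) ∑ x_i ⊗ x_i` of the sample points `x_1, …, x_N`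
in `ℝⁿ`. -/
noncomputable def sampleCovarianceMatrix {n N : ℕ} (x : Fin N → EuclideanSpace ℝ (Fin n)) :
    Matrix (Fin n) (Fin n) ℝ :=
  (1 / (N : ℝ)) • ∑ i, Matrix.vecMulVec (x i).ofLp (x i).ofLp

/-! ### Scalar inequalities for powers. -/

section Scalar

/-! The proof is a trace moment method with exchangeable pairs. Let `S = ∑ (X_i ⊗ X_i - Σ)` and `e_q
= 𝔼 tr S^q`. In `e_{2r+2} = ∑_j 𝔼 tr ((X_j ⊗ X_j - Σ) S^{2r+1})`, write `Σ` as the mean of `X_0 ⊗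
X_0` for an independent copy `X_0`. Exchanging `X_0` and `X_j` flips the sign of `D = X_j ⊗ X_j -
X_0 ⊗ X_0` and turns `S` into `S' = S - D`, so the summand is half of `𝔼 tr (D (S^{2r+1} -
S'^{2r+1}))`. A trace mean value inequality bounds this by `D²` against even powers, and `D² ≤ 2m
(X_j ⊗ X_j + X_0 ⊗ X_0)` because the summands have rank one and norm at most `m`
(`integral_trace_sub_mul_pow_le`).

Summing over `j` gives `e_{2r+2} ≤ L (e_{2r+1} + 2N‖Σ‖ e_{2r})` with `L = (2r+1)m`. Absorbing the
odd moment leaves `e_{2r+2} ≤ (L² + 4LN‖Σ‖) e_{2r}`, which is iterated from `e_0 = n`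
(`integral_trace_sampleDeviation_pow_le`). Markov's inequality at an exponent `2p` with `p` of order
`t² log n` gives the tail. -/

theorem pow_mul_pow_add_le {a b : ℝ} (ha : 0 ≤ a) (hb : 0 ≤ b) (i j : ℕ) :
    a ^ i * b ^ j + a ^ j * b ^ i ≤ a ^ (i + j) + b ^ (i + j) := by
  -- Both factors have the sign of `a - b`.
  have key : 0 ≤ (a ^ i - b ^ i) * (a ^ j - b ^ j) := by
    rcases le_total a b with h | h
    · exact mul_nonneg_of_nonpos_of_nonpos (sub_nonpos.2 (pow_le_pow_left₀ ha h i))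
        (sub_nonpos.2 (pow_le_pow_left₀ ha h j))
    · exact mul_nonneg (sub_nonneg.2 (pow_le_pow_left₀ hb h i))
        (sub_nonneg.2 (pow_le_pow_left₀ hb h j))
  rw [pow_add, pow_add]
  linarith

/-- A mean value inequality for odd powers. -/
theorem sub_mul_pow_sub_pow_le (a b : ℝ) (r : ℕ) :
    2 * ((a - b) * (a ^ (2 * r + 1) - b ^ (2 * r + 1))) ≤
      (2 * r + 1) * ((a - b) ^ 2 * (a ^ (2 * r) + b ^ (2 * r))) := by
  have hgeom := (Commute.all a b).geom_sum₂_mul (2 * r + 1)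
  have hsum : 2 * ∑ i ∈ Finset.range (2 * r + 1), a ^ i * b ^ (2 * r + 1 - 1 - i) ≤
      (2 * r + 1) * (a ^ (2 * r) + b ^ (2 * r)) := by
    have hrefl := Finset.sum_range_reflect
      (fun i => a ^ i * b ^ (2 * r + 1 - 1 - i)) (2 * r + 1)
    -- Each term of the geometric sum is paired with its reflection. The total degree `2r` is even,
    -- so passing to `|a|`, `|b|` leaves the bound unchanged.
    calc 2 * ∑ i ∈ Finset.range (2 * r + 1), a ^ i * b ^ (2 * r + 1 - 1 - i)
        = ∑ i ∈ Finset.range (2 * r + 1), (a ^ i * b ^ (2 * r - i) + a ^ (2 * r - i) * b ^ i) := by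
          rw [two_mul]
          nth_rw 2 [← hrefl]
          rw [← Finset.sum_add_distrib]
          refine Finset.sum_congr rfl fun i hi => ?_
          have hi' : i ≤ 2 * r := Nat.lt_succ_iff.1 (Finset.mem_range.1 hi)
          rw [Nat.add_sub_cancel, Nat.sub_sub_self hi']
      _ ≤ ∑ _i ∈ Finset.range (2 * r + 1), (a ^ (2 * r) + b ^ (2 * r)) := by
          refine Finset.sum_le_sum fun i hi => ?_
          have hi' : i ≤ 2 * r := Nat.lt_succ_iff.1 (Finset.mem_range.1 hi)
          have h := pow_mul_pow_add_le (abs_nonneg a) (abs_nonneg b) i (2 * r - i)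
          rw [Nat.add_sub_cancel' hi', (even_two_mul r).pow_abs, (even_two_mul r).pow_abs] at h
          refine le_trans (add_le_add ?_ ?_) h <;>
            (rw [← abs_pow, ← abs_pow, ← abs_mul]; exact le_abs_self _)
      _ = (2 * r + 1) * (a ^ (2 * r) + b ^ (2 * r)) := by
          simp [mul_add]
  rw [← hgeom]
  nlinarith [mul_le_mul_of_nonneg_left hsum (sq_nonneg (a - b))]

end Scalar

/-! ### Trace inequalities for real symmetric matrices. -/

namespace Matrix

variable {ι : Type*} [Fintype ι] [DecidableEq ι]

theorem IsHermitian.pow_eq_conj_diagonal {A : Matrix ι ι ℝ} (hA : A.IsHermitian) (k : ℕ) :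
    A ^ k = (hA.eigenvectorUnitary : Matrix ι ι ℝ) * diagonal (fun i => hA.eigenvalues i ^ k) *
      star (hA.eigenvectorUnitary : Matrix ι ι ℝ) := by
  conv_lhs => rw [hA.spectral_theorem]
  rw [← map_pow, Unitary.conjStarAlgAut_apply, diagonal_pow]
  rfl

/-- Joint spectral representation of the traces `tr (Aᵏ Bˡ)`. -/
theorem IsHermitian.trace_pow_mul_pow {A B : Matrix ι ι ℝ} (hA : A.IsHermitian)
    (hB : B.IsHermitian) :
    ∃ (w : ι → ι → ℝ) (a b : ι → ℝ), (∀ i j, 0 ≤ w i j) ∧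
      ∀ k l : ℕ, trace (A ^ k * B ^ l) = ∑ i, ∑ j, w i j * (a i ^ k * b j ^ l) := by
  let U : Matrix ι ι ℝ := hA.eigenvectorUnitary
  let V : Matrix ι ι ℝ := hB.eigenvectorUnitary
  -- The weights are the squared inner products of the two eigenbases.
  refine ⟨fun i j => (star U * V) i j ^ 2, hA.eigenvalues, hB.eigenvalues,
    fun i j => sq_nonneg _, fun k l => ?_⟩
  set D := diagonal (fun i => hA.eigenvalues i ^ k)
  set E := diagonal (fun i => hB.eigenvalues i ^ l)
  have h : trace (A ^ k * B ^ l) = trace (D * (star U * V) * (E * star (star U * V))) := by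
    rw [hA.pow_eq_conj_diagonal, hB.pow_eq_conj_diagonal]
    change trace (U * D * star U * (V * E * star V)) = _
    rw [star_mul, star_star, mul_assoc U, mul_assoc U, trace_mul_comm]
    simp only [mul_assoc]
  rw [h, trace]
  refine Finset.sum_congr rfl fun i _ => ?_
  rw [diag_apply, mul_apply]
  refine Finset.sum_congr rfl fun j _ => ?_
  simp only [D, E, diagonal_mul, star_apply, star_trivial]
  ring

/-- A mean value inequality for the trace of odd powers. -/
theorem IsHermitian.trace_sub_mul_pow_sub_pow_le {A B : Matrix ι ι ℝ} (hA : A.IsHermitian)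
    (hB : B.IsHermitian) (r : ℕ) :
    2 * trace ((A - B) * (A ^ (2 * r + 1) - B ^ (2 * r + 1))) ≤
      (2 * r + 1) * trace ((A - B) ^ 2 * (A ^ (2 * r) + B ^ (2 * r))) := by
  obtain ⟨w, a, b, hw, h⟩ := hA.trace_pow_mul_pow hB
  -- By cyclicity both sides are combinations of traces `tr (Aᵏ Bˡ)`, so the claim becomes a
  -- nonnegatively weighted sum of the scalar inequality over pairs of eigenvalues.
  have e1 : trace ((A - B) * (A ^ (2 * r + 1) - B ^ (2 * r + 1))) =
      trace (A ^ (2 * r + 2) * B ^ 0) - trace (A ^ 1 * B ^ (2 * r + 1))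
        - trace (A ^ (2 * r + 1) * B ^ 1) + trace (A ^ 0 * B ^ (2 * r + 2)) := by
    rw [trace_mul_comm (A ^ (2 * r + 1)) (B ^ 1), pow_zero, pow_zero, pow_one, pow_one, mul_one,
      one_mul, pow_succ' A (2 * r + 1), pow_succ' B (2 * r + 1), sub_mul, mul_sub, mul_sub]
    simp only [trace_sub]
    ring
  have e2 : trace ((A - B) ^ 2 * (A ^ (2 * r) + B ^ (2 * r))) =
      trace (A ^ (2 * r + 2) * B ^ 0) + trace (A ^ 2 * B ^ (2 * r))
        - 2 * trace (A ^ (2 * r + 1) * B ^ 1) - 2 * trace (A ^ 1 * B ^ (2 * r + 1))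
        + trace (A ^ (2 * r) * B ^ 2) + trace (A ^ 0 * B ^ (2 * r + 2)) := by
    have c1 : trace (A * B * A ^ (2 * r)) = trace (A ^ (2 * r + 1) * B ^ 1) := by
      rw [trace_mul_comm, ← mul_assoc, ← pow_succ, pow_one]
    have c2 : trace (B * A * A ^ (2 * r)) = trace (A ^ (2 * r + 1) * B ^ 1) := by
      rw [mul_assoc, ← pow_succ', trace_mul_comm, pow_one]
    have c3 : trace (A * B * B ^ (2 * r)) = trace (A ^ 1 * B ^ (2 * r + 1)) := by
      rw [mul_assoc, ← pow_succ', pow_one]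
    have c4 : trace (B * A * B ^ (2 * r)) = trace (A ^ 1 * B ^ (2 * r + 1)) := by
      rw [trace_mul_cycle, ← pow_succ, trace_mul_comm, pow_one]
    have c5 : trace (B * B * A ^ (2 * r)) = trace (A ^ (2 * r) * B ^ 2) := by
      rw [trace_mul_comm, sq]
    have c6 : trace (A * A * A ^ (2 * r)) = trace (A ^ (2 * r + 2) * B ^ 0) := by
      rw [← sq, ← pow_add, add_comm, pow_zero, mul_one]
    have c7 : trace (B * B * B ^ (2 * r)) = trace (A ^ 0 * B ^ (2 * r + 2)) := by
      rw [← sq, ← pow_add, add_comm, pow_zero, one_mul]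
    have c8 : trace (A * A * B ^ (2 * r)) = trace (A ^ 2 * B ^ (2 * r)) := by rw [← sq]
    rw [sq (A - B)]
    simp only [sub_mul, mul_sub, mul_add, trace_sub, trace_add, c1, c2, c3, c4, c5, c6, c7, c8]
    ring
  rw [e1, e2]
  simp only [h, Finset.mul_sum, ← Finset.sum_add_distrib, ← Finset.sum_sub_distrib]
  refine Finset.sum_le_sum fun i _ => Finset.sum_le_sum fun j _ => ?_
  have := mul_le_mul_of_nonneg_left (sub_mul_pow_sub_pow_le (a i) (b j) r) (hw i j)
  simp only [pow_zero, mul_one, one_mul, pow_succ] at this ⊢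
  linarith

/-- The trace equals that of the positive semidefinite matrix `Sʳ P Sʳ`. -/
theorem PosSemidef.trace_mul_pow_nonneg {P S : Matrix ι ι ℝ} (hP : P.PosSemidef)
    (hS : S.IsHermitian) (r : ℕ) : 0 ≤ trace (P * S ^ (2 * r)) := by
  have h := (hP.conjTranspose_mul_mul_same (S ^ r)).trace_nonneg
  rwa [(hS.pow r).eq, mul_assoc, trace_mul_comm, mul_assoc, ← pow_add, ← two_mul] at h

theorem trace_mul_pow_le {P Q S : Matrix ι ι ℝ} (h : (Q - P).PosSemidef)
    (hS : S.IsHermitian) (r : ℕ) : trace (P * S ^ (2 * r)) ≤ trace (Q * S ^ (2 * r)) := by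
  have := h.trace_mul_pow_nonneg hS r
  rw [sub_mul, trace_sub] at this
  linarith

theorem IsHermitian.posSemidef_sq {A : Matrix ι ι ℝ} (hA : A.IsHermitian) :
    (A ^ 2).PosSemidef := by
  have h := posSemidef_conjTranspose_mul_self A
  rwa [hA.eq, ← sq] at h

theorem IsHermitian.trace_pow_nonneg {S : Matrix ι ι ℝ} (hS : S.IsHermitian) (r : ℕ) :
    0 ≤ trace (S ^ (2 * r)) := by
  simpa using (PosSemidef.one (n := ι) (R := ℝ)).trace_mul_pow_nonneg hS r

/-- Expand `tr ((S - K)² S^{2r}) ≥ 0`. This controls odd moments, which have no sign, by the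
neighbouring even ones. -/
theorem IsHermitian.mul_trace_odd_pow_le {S : Matrix ι ι ℝ} (hS : S.IsHermitian) (K : ℝ) (r : ℕ) :
    2 * K * trace (S ^ (2 * r + 1)) ≤ trace (S ^ (2 * (r + 1))) + K ^ 2 * trace (S ^ (2 * r)) := by
  have hK : (S - K • (1 : Matrix ι ι ℝ)).IsHermitian :=
    hS.sub (by simp [IsHermitian])
  have h := hK.posSemidef_sq.trace_mul_pow_nonneg hS r
  have e : (S - K • (1 : Matrix ι ι ℝ)) ^ 2 * S ^ (2 * r) =
      S ^ (2 * (r + 1)) - (2 * K) • S ^ (2 * r + 1) + K ^ 2 • S ^ (2 * r) := by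
    rw [sq, sub_mul, mul_sub, mul_sub, mul_smul_comm, smul_mul_assoc, smul_mul_assoc,
      mul_smul_comm, mul_one, one_mul, mul_one, sub_mul, sub_mul, sub_mul, smul_mul_assoc,
      smul_mul_assoc, smul_mul_assoc, one_mul, mul_assoc, ← pow_succ', ← pow_succ', smul_smul,
      two_mul K, add_smul, ← sq]
    have : 2 * (r + 1) = 2 * r + 1 + 1 := by ring
    rw [this]
    abel
  rw [e, trace_add, trace_sub, trace_smul, trace_smul, smul_eq_mul, smul_eq_mul] at h
  linarith

theorem IsHermitian.norm_pow_le_trace [Nonempty ι] {S : Matrix ι ι ℝ} (hS : S.IsHermitian)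
    (r : ℕ) : ‖S‖ ^ (2 * r) ≤ trace (S ^ (2 * r)) := by
  have hn : ‖S‖ = ‖hS.eigenvalues‖ := by
    have h := hS.pow_eq_conj_diagonal 1
    simp only [pow_one] at h
    conv_lhs => rw [h]
    rw [← Unitary.coe_star, CStarRing.norm_mul_coe_unitary, CStarRing.norm_coe_unitary_mul,
      l2_opNorm_diagonal]
  obtain ⟨i, hi⟩ : ∃ i, ‖hS.eigenvalues‖ = ‖hS.eigenvalues i‖ := by
    obtain ⟨i, -, hi⟩ := Finset.exists_max_image Finset.univ
      (fun i => ‖hS.eigenvalues i‖) Finset.univ_nonempty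
    exact ⟨i, le_antisymm ((pi_norm_le_iff_of_nonneg (norm_nonneg _)).2
      fun j => hi j (Finset.mem_univ j)) (norm_le_pi_norm _ i)⟩
  have ht : trace (S ^ (2 * r)) = ∑ i, hS.eigenvalues i ^ (2 * r) := by
    rw [hS.pow_eq_conj_diagonal, trace_mul_comm, ← mul_assoc, Unitary.coe_star_mul_self, one_mul,
      trace_diagonal]
  rw [hn, hi, ht, Real.norm_eq_abs, (even_two_mul r).pow_abs]
  exact Finset.single_le_sum (f := fun i => hS.eigenvalues i ^ (2 * r))
    (fun j _ => (even_two_mul r).pow_nonneg _) (Finset.mem_univ i)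

theorem IsHermitian.posSemidef_norm_smul_one_sub {S : Matrix ι ι ℝ} (hS : S.IsHermitian) :
    (‖S‖ • (1 : Matrix ι ι ℝ) - S).PosSemidef := by
  refine .of_dotProduct_mulVec_nonneg (IsHermitian.sub (by simp [IsHermitian]) hS)
    fun x => ?_
  have h := real_inner_le_norm (WithLp.toLp 2 x) (WithLp.toLp 2 (S.mulVec x))
  have h2 := S.l2_opNorm_mulVec (WithLp.toLp 2 x)
  have h3 := mul_le_mul_of_nonneg_left h2 (norm_nonneg (WithLp.toLp 2 x))
  have h4 : ‖WithLp.toLp 2 x‖ * ‖WithLp.toLp 2 x‖ = x ⬝ᵥ x := by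
    rw [← real_inner_self_eq_norm_mul_norm, EuclideanSpace.inner_eq_star_dotProduct]
    simp
  rw [EuclideanSpace.inner_eq_star_dotProduct] at h
  simp only [star_trivial, sub_mulVec, smul_mulVec, one_mulVec, dotProduct_sub,
    dotProduct_smul, smul_eq_mul] at h ⊢
  rw [dotProduct_comm] at h
  have h5 : ‖WithLp.toLp 2 x‖ * (‖S‖ * ‖WithLp.toLp 2 x‖) = ‖S‖ * (x ⬝ᵥ x) := by
    rw [← h4]; ring
  simp only [EuclideanSpace.equiv] at h3
  linarith [h.trans h3]

theorem isHermitian_vecMulVec_self {ι : Type*} [Fintype ι] (x : ι → ℝ) : (vecMulVec x x).IsHermitian := by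
  simpa using (posSemidef_vecMulVec_self_star x).isHermitian

theorem vecMulVec_self_sq (x : ι → ℝ) : vecMulVec x x ^ 2 = (x ⬝ᵥ x) • vecMulVec x x := by
  rw [sq, vecMulVec_mul_vecMulVec, vecMulVec_smul]

/-- With `A = x ⊗ x` and `B = y ⊗ y`, drop `(A + B)²` from `(A - B)² = 2A² + 2B² - (A + B)²` and use
`A² = |x|² A`, `B² = |y|² B`. -/
theorem trace_sq_vecMulVec_sub_mul_pow_le {S : Matrix ι ι ℝ} (hS : S.IsHermitian) {x y : ι → ℝ}
    {m : ℝ} (hx : x ⬝ᵥ x ≤ m) (hy : y ⬝ᵥ y ≤ m) (r : ℕ) :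
    trace ((vecMulVec x x - vecMulVec y y) ^ 2 * S ^ (2 * r)) ≤
      2 * m * trace ((vecMulVec x x + vecMulVec y y) * S ^ (2 * r)) := by
  set A := vecMulVec x x with hA
  set B := vecMulVec y y with hB
  have h1 := ((isHermitian_vecMulVec_self x).add
    (isHermitian_vecMulVec_self y)).posSemidef_sq.trace_mul_pow_nonneg hS r
  have hx0 : 0 ≤ trace (A * S ^ (2 * r)) := by
    simpa using (posSemidef_vecMulVec_self_star x).trace_mul_pow_nonneg hS r
  have hy0 : 0 ≤ trace (B * S ^ (2 * r)) := by
    simpa using (posSemidef_vecMulVec_self_star y).trace_mul_pow_nonneg hS r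
  have e : (A - B) ^ 2 = (2 * (x ⬝ᵥ x)) • A + (2 * (y ⬝ᵥ y)) • B - (A + B) ^ 2 := by
    rw [mul_smul, mul_smul, ← vecMulVec_self_sq, ← vecMulVec_self_sq, ← hA, ← hB, two_smul, two_smul]
    noncomm_ring
  rw [e, sub_mul, add_mul, trace_sub, trace_add, smul_mul_assoc, smul_mul_assoc, trace_smul,
    trace_smul, add_mul, trace_add, smul_eq_mul, smul_eq_mul]
  nlinarith [mul_le_mul_of_nonneg_right hx hx0, mul_le_mul_of_nonneg_right hy hy0]

end Matrix

/-! ### Independence, exchangeability and integrability under product measures. -/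

section PiMeasure

variable {E : Type*} [MeasurableSpace E]

theorem integral_pi_head_mul_tail (P : Measure E) [IsProbabilityMeasure P] {N : ℕ} (f : E → ℝ)
    (g : (Fin N → E) → ℝ) :
    ∫ ω : Fin (N + 1) → E, f (ω 0) * g (Fin.tail ω) ∂Measure.pi (fun _ => P) =
      (∫ x, f x ∂P) * ∫ ω, g ω ∂Measure.pi (fun _ => P) := by
  rw [← integral_prod_mul,
    ← (measurePreserving_piFinSuccAbove (fun _ : Fin (N + 1) => P) 0).integral_comp']
  rfl

theorem integral_pi_tail (P : Measure E) [IsProbabilityMeasure P] {N : ℕ}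
    (g : (Fin N → E) → ℝ) :
    ∫ ω : Fin (N + 1) → E, g (Fin.tail ω) ∂Measure.pi (fun _ => P) =
      ∫ ω, g ω ∂Measure.pi (fun _ => P) := by
  simpa using integral_pi_head_mul_tail P (fun _ => 1) g

theorem integral_pi_comp_perm (P : Measure E) [IsProbabilityMeasure P] {ι : Type*}
    [Fintype ι] (σ : Equiv.Perm ι) (f : (ι → E) → ℝ) :
    ∫ ω, f (ω ∘ σ) ∂Measure.pi (fun _ => P) = ∫ ω, f ω ∂Measure.pi (fun _ => P) := by
  have h : (fun ω : ι → E => ω ∘ σ) = MeasurableEquiv.piCongrLeft (fun _ : ι => E) σ.symm := by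
    ext ω i
    have := MeasurableEquiv.piCongrLeft_apply_apply (β := fun _ : ι => E) σ.symm ω (σ i)
    simpa using this.symm
  have := (measurePreserving_piCongrLeft (fun _ : ι => P) σ.symm).integral_comp' (g := f)
  rwa [← h] at this

/-- The product measure is carried by the compact set `K^ι`. This reduces every later integrability
question to continuity. -/
theorem Continuous.integrable_pi_of_ae_mem_isCompact [TopologicalSpace E] [OpensMeasurableSpace E]
    [SecondCountableTopology E] [T2Space E] {P : Measure E} [IsProbabilityMeasure P] {K : Set E}
    (hK : IsCompact K)
    (hP : ∀ᵐ x ∂P, x ∈ K) {ι : Type*} [Fintype ι] {f : (ι → E) → ℝ} (hf : Continuous f) :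
    Integrable f (Measure.pi fun _ => P) := by
  have hKc : IsCompact (Set.univ.pi fun _ : ι => K) := isCompact_univ_pi fun _ => hK
  have hae : ∀ᵐ ω ∂Measure.pi (fun _ : ι => P), ω ∈ Set.univ.pi fun _ : ι => K := by
    have : ∀ i : ι, ∀ᵐ ω ∂Measure.pi (fun _ : ι => P), ω i ∈ K := fun i =>
      (measurePreserving_eval (fun _ : ι => P) i).quasiMeasurePreserving.ae hP
    filter_upwards [ae_all_iff.2 this] with ω hω i _ using hω i
  rw [← Measure.restrict_eq_self_of_ae_mem hae]
  exact hf.continuousOn.integrableOn_compact hKc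

end PiMeasure

/-! ### The sample deviation and the exchange of one sample point. -/

section SampleDeviation

variable {n N : ℕ}

/-- The unnormalised deviation `∑ (x_i ⊗ x_i - M)` of sample points from a matrix `M`. -/
noncomputable def sampleDeviation (M : Matrix (Fin n) (Fin n) ℝ)
    (x : Fin N → EuclideanSpace ℝ (Fin n)) : Matrix (Fin n) (Fin n) ℝ :=
  ∑ i, (Matrix.vecMulVec (x i).ofLp (x i).ofLp - M)

theorem continuous_sampleDeviation (M : Matrix (Fin n) (Fin n) ℝ) :
    Continuous (sampleDeviation (N := N) M) := by
  unfold sampleDeviation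
  fun_prop

theorem isHermitian_sampleDeviation {M : Matrix (Fin n) (Fin n) ℝ} (hM : M.IsHermitian)
    (x : Fin N → EuclideanSpace ℝ (Fin n)) : (sampleDeviation M x).IsHermitian := by
  unfold sampleDeviation Matrix.IsHermitian
  rw [Matrix.conjTranspose_sum]
  exact Finset.sum_congr rfl fun i _ => (Matrix.isHermitian_vecMulVec_self _).sub hM

theorem isHermitian_secondMomentMatrix (P : Measure (EuclideanSpace ℝ (Fin n))) :
    (secondMomentMatrix P).IsHermitian := by
  ext i j
  simp [secondMomentMatrix, mul_comm]

theorem sampleDeviation_sub_comp_swap (M : Matrix (Fin n) (Fin n) ℝ)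
    (ω : Fin (N + 1) → EuclideanSpace ℝ (Fin n)) (j : Fin N) :
    sampleDeviation M (Fin.tail ω) - sampleDeviation M (Fin.tail (ω ∘ Equiv.swap j.succ 0)) =
      Matrix.vecMulVec (ω j.succ).ofLp (ω j.succ).ofLp - Matrix.vecMulVec (ω 0).ofLp (ω 0).ofLp := by
  unfold sampleDeviation
  rw [← Finset.sum_sub_distrib, Finset.sum_eq_single j]
  · simp [Fin.tail]
  · intro i _ hij
    simp [Fin.tail, Equiv.swap_apply_of_ne_of_ne (fun h => hij (Fin.succ_injective _ h))
      (Fin.succ_ne_zero i)]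
  · simp

theorem dotProduct_self_le_of_mem_closedBall {m : ℝ} (hm : 0 ≤ m) {x : EuclideanSpace ℝ (Fin n)}
    (hx : x ∈ Metric.closedBall (0 : EuclideanSpace ℝ (Fin n)) (√m)) :
    x.ofLp ⬝ᵥ x.ofLp ≤ m := by
  have h : ‖x‖ ^ 2 = x.ofLp ⬝ᵥ x.ofLp := by
    rw [EuclideanSpace.norm_sq_eq]
    simp [dotProduct, sq]
  rw [← h, ← Real.sq_sqrt hm]
  exact pow_le_pow_left₀ (norm_nonneg _) (mem_closedBall_zero_iff.1 hx) 2

variable {P : Measure (EuclideanSpace ℝ (Fin n))} [IsProbabilityMeasure P] {m : ℝ}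

theorem integrable_pi_of_ae_mem_closedBall {R : ℝ}
    (hP : ∀ᵐ x ∂P, x ∈ Metric.closedBall (0 : EuclideanSpace ℝ (Fin n)) R) {ι : Type*} [Fintype ι]
    {f : (ι → EuclideanSpace ℝ (Fin n)) → ℝ} (hf : Continuous f) :
    Integrable f (Measure.pi fun _ => P) :=
  hf.integrable_pi_of_ae_mem_isCompact (isCompact_closedBall _ _) hP

/-- Coordinate `0` is independent of the tail, so it can be integrated out entry by entry. Read
backwards, this replaces `Σ` by an independent copy. -/
theorem integral_trace_vecMulVec_head_mul {R : ℝ}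
    (hP : ∀ᵐ x ∂P, x ∈ Metric.closedBall (0 : EuclideanSpace ℝ (Fin n)) R)
    {G : (Fin N → EuclideanSpace ℝ (Fin n)) → Matrix (Fin n) (Fin n) ℝ} (hG : Continuous G) :
    ∫ ω : Fin (N + 1) → EuclideanSpace ℝ (Fin n),
        (Matrix.vecMulVec (ω 0).ofLp (ω 0).ofLp * G (Fin.tail ω)).trace ∂Measure.pi (fun _ => P) =
      ∫ ω, (secondMomentMatrix P * G ω).trace ∂Measure.pi (fun _ => P) := by
  have hT : Continuous fun ω : Fin (N + 1) → EuclideanSpace ℝ (Fin n) => Fin.tail ω := by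
    unfold Fin.tail; fun_prop
  simp only [Matrix.trace, Matrix.diag_apply, Matrix.mul_apply]
  rw [integral_finsetSum _ fun i _ => integrable_pi_of_ae_mem_closedBall hP (by
      simp only [Matrix.vecMulVec_apply]; fun_prop),
    integral_finsetSum _ fun i _ => integrable_pi_of_ae_mem_closedBall hP (by fun_prop)]
  refine Finset.sum_congr rfl fun i _ => ?_
  rw [integral_finsetSum _ fun j _ => integrable_pi_of_ae_mem_closedBall hP (by
      simp only [Matrix.vecMulVec_apply]; fun_prop),
    integral_finsetSum _ fun j _ => integrable_pi_of_ae_mem_closedBall hP (by fun_prop)]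
  refine Finset.sum_congr rfl fun j _ => ?_
  rw [integral_const_mul]
  exact integral_pi_head_mul_tail P (fun x => x i * x j) fun ω => G ω j i

/-- Exchanging one sample point for an independent copy. -/
theorem integral_trace_sub_mul_pow_le (hm : 0 ≤ m)
    (hP : ∀ᵐ x ∂P, x ∈ Metric.closedBall (0 : EuclideanSpace ℝ (Fin n)) (√m)) (j : Fin N) (r : ℕ) :
    ∫ ω : Fin N → EuclideanSpace ℝ (Fin n),
        ((Matrix.vecMulVec (ω j).ofLp (ω j).ofLp - secondMomentMatrix P) *
          sampleDeviation (secondMomentMatrix P) ω ^ (2 * r + 1)).trace ∂Measure.pi (fun _ => P) ≤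
      (2 * r + 1) * m * ∫ ω : Fin N → EuclideanSpace ℝ (Fin n),
        ((Matrix.vecMulVec (ω j).ofLp (ω j).ofLp + secondMomentMatrix P) *
          sampleDeviation (secondMomentMatrix P) ω ^ (2 * r)).trace ∂Measure.pi (fun _ => P) := by
  set M := secondMomentMatrix P with hMdef
  have hM : M.IsHermitian := isHermitian_secondMomentMatrix P
  have hS := continuous_sampleDeviation (N := N) M
  have hT : Continuous fun ω : Fin (N + 1) → EuclideanSpace ℝ (Fin n) => Fin.tail ω := by
    unfold Fin.tail; fun_prop
  set σ : Equiv.Perm (Fin (N + 1)) := Equiv.swap j.succ 0 with hσ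
  set V : EuclideanSpace ℝ (Fin n) → Matrix (Fin n) (Fin n) ℝ :=
    fun x => Matrix.vecMulVec x.ofLp x.ofLp with hV
  have hVc : Continuous V := by simp only [hV]; fun_prop
  set T : (Fin (N + 1) → EuclideanSpace ℝ (Fin n)) → Matrix (Fin n) (Fin n) ℝ :=
    fun ω => sampleDeviation M (Fin.tail ω) with hTdef
  have hTc : Continuous T := hS.comp hT
  have hTσ : Continuous fun ω => T (ω ∘ σ) := hTc.comp (by fun_prop)
  have hsub : ∀ ω, T ω - T (ω ∘ σ) = V (ω j.succ) - V (ω 0) := fun ω =>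
    sampleDeviation_sub_comp_swap M ω j
  have hσj : σ j.succ = 0 := Equiv.swap_apply_left _ _
  have hσ0 : σ 0 = j.succ := Equiv.swap_apply_right _ _
  -- Used with `c = -1` for the left side of the goal and `c = 1` for the right.
  have lhs : ∀ (c : ℝ) (q : ℕ), ∫ ω : Fin N → EuclideanSpace ℝ (Fin n),
      ((V (ω j) + c • M) * sampleDeviation M ω ^ q).trace ∂Measure.pi (fun _ => P) =
      ∫ ω : Fin (N + 1) → EuclideanSpace ℝ (Fin n),
        ((V (ω j.succ) + c • V (ω 0)) * T ω ^ q).trace ∂Measure.pi (fun _ => P) := by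
    intro c q
    have h1 := integral_trace_vecMulVec_head_mul (P := P) (N := N) hP (hS.pow q)
    have h2 := integral_pi_tail P fun ω : Fin N → EuclideanSpace ℝ (Fin n) =>
      (V (ω j) * sampleDeviation M ω ^ q).trace
    simp only [add_mul, Matrix.trace_add, Matrix.smul_mul, Matrix.trace_smul]
    rw [integral_add (integrable_pi_of_ae_mem_closedBall hP (by fun_prop))
      (integrable_pi_of_ae_mem_closedBall hP (by fun_prop)),
      integral_add (integrable_pi_of_ae_mem_closedBall hP (by fun_prop))
      (integrable_pi_of_ae_mem_closedBall hP (by fun_prop)), integral_smul, integral_smul]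
    exact congrArg₂ (fun a b => a + c • b) h2.symm h1.symm
  have l1 := lhs (-1) (2 * r + 1)
  have l2 := lhs 1 (2 * r)
  simp only [neg_smul, one_smul, ← sub_eq_add_neg] at l1 l2
  rw [l1, l2]
  have hF := integral_pi_comp_perm P σ fun ω : Fin (N + 1) → EuclideanSpace ℝ (Fin n) =>
    ((V (ω j.succ) - V (ω 0)) * T ω ^ (2 * r + 1)).trace
  have hG := integral_pi_comp_perm P σ fun ω : Fin (N + 1) → EuclideanSpace ℝ (Fin n) =>
    ((V (ω j.succ) - V (ω 0)) ^ 2 * T ω ^ (2 * r)).trace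
  simp only [Function.comp_apply, hσj, hσ0] at hF hG
  -- Each doubled integral is the integral plus its image under the swap; the left integrand's
  -- prefactor is antisymmetric and the squared one symmetric, which produces the two sides of the
  -- mean value inequality.
  have step1 : 2 * (2 * ∫ ω : Fin (N + 1) → EuclideanSpace ℝ (Fin n),
      ((V (ω j.succ) - V (ω 0)) * T ω ^ (2 * r + 1)).trace ∂Measure.pi (fun _ => P)) ≤
      (2 * r + 1) * (2 * ∫ ω : Fin (N + 1) → EuclideanSpace ℝ (Fin n),
      ((V (ω j.succ) - V (ω 0)) ^ 2 * T ω ^ (2 * r)).trace ∂Measure.pi (fun _ => P)) := by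
    rw [two_mul (∫ _, _ ∂_), two_mul (∫ _, _ ∂_)]
    nth_rw 2 [← hF]
    nth_rw 2 [← hG]
    rw [← integral_add (integrable_pi_of_ae_mem_closedBall hP (by fun_prop))
      (integrable_pi_of_ae_mem_closedBall hP (by fun_prop)),
      ← integral_add (integrable_pi_of_ae_mem_closedBall hP (by fun_prop))
      (integrable_pi_of_ae_mem_closedBall hP (by fun_prop)), ← integral_const_mul,
      ← integral_const_mul]
    refine integral_mono (integrable_pi_of_ae_mem_closedBall hP (by fun_prop))
      (integrable_pi_of_ae_mem_closedBall hP (by fun_prop)) fun ω => ?_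
    have h := (isHermitian_sampleDeviation hM (Fin.tail ω)).trace_sub_mul_pow_sub_pow_le
      (isHermitian_sampleDeviation hM (Fin.tail (ω ∘ σ))) r
    change _ * ((T ω - T (ω ∘ σ)) * (T ω ^ _ - T (ω ∘ σ) ^ _)).trace ≤
      _ * ((T ω - T (ω ∘ σ)) ^ 2 * (T ω ^ _ + T (ω ∘ σ) ^ _)).trace at h
    rw [hsub, mul_sub, mul_add, Matrix.trace_sub, Matrix.trace_add] at h
    have e1 : (V (ω 0) - V (ω j.succ)) = -(V (ω j.succ) - V (ω 0)) := by abel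
    simp only [e1, neg_mul, Matrix.trace_neg, neg_sq]
    linarith
  have step2 : ∫ ω : Fin (N + 1) → EuclideanSpace ℝ (Fin n),
      ((V (ω j.succ) - V (ω 0)) ^ 2 * T ω ^ (2 * r)).trace ∂Measure.pi (fun _ => P) ≤
      2 * m * ∫ ω : Fin (N + 1) → EuclideanSpace ℝ (Fin n),
      ((V (ω j.succ) + V (ω 0)) * T ω ^ (2 * r)).trace ∂Measure.pi (fun _ => P) := by
    rw [← integral_const_mul]
    refine integral_mono_ae (integrable_pi_of_ae_mem_closedBall hP (by fun_prop))
      (integrable_pi_of_ae_mem_closedBall hP (by fun_prop)) ?_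
    have hae : ∀ i, ∀ᵐ ω ∂Measure.pi (fun _ : Fin (N + 1) => P), ω i ∈ Metric.closedBall 0 (√m) :=
      fun i => (measurePreserving_eval (fun _ => P) i).quasiMeasurePreserving.ae hP
    filter_upwards [hae j.succ, hae 0] with ω h1 h2
    exact Matrix.trace_sq_vecMulVec_sub_mul_pow_le (isHermitian_sampleDeviation hM _)
      (dotProduct_self_le_of_mem_closedBall hm h1) (dotProduct_self_le_of_mem_closedBall hm h2) r
  have hr : (0 : ℝ) ≤ 2 * r + 1 := by positivity
  nlinarith [mul_le_mul_of_nonneg_left step2 hr]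

end SampleDeviation

/-! ### Moment recursion, Markov's inequality and the choice of constants. -/

section Moments

variable {n N : ℕ} {P : Measure (EuclideanSpace ℝ (Fin n))} [IsProbabilityMeasure P] {m : ℝ}

/-- The free bound `K` makes the factor independent of `r`, so that the recursion can be iterated.
-/
theorem integral_trace_sampleDeviation_pow_succ_le (hm : 0 ≤ m)
    (hP : ∀ᵐ x ∂P, x ∈ Metric.closedBall (0 : EuclideanSpace ℝ (Fin n)) (√m)) (r : ℕ) {K : ℝ}
    (hK : (2 * r + 1) * m ≤ K) :
    ∫ ω : Fin N → EuclideanSpace ℝ (Fin n),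
        (sampleDeviation (secondMomentMatrix P) ω ^ (2 * (r + 1))).trace ∂Measure.pi (fun _ => P) ≤
      (K ^ 2 + 4 * K * (N * ‖secondMomentMatrix P‖)) *
        ∫ ω : Fin N → EuclideanSpace ℝ (Fin n),
          (sampleDeviation (secondMomentMatrix P) ω ^ (2 * r)).trace ∂Measure.pi (fun _ => P) := by
  set M := secondMomentMatrix P with hMdef
  have hM : M.IsHermitian := isHermitian_secondMomentMatrix P
  have hS := continuous_sampleDeviation (N := N) M
  set L := (2 * r + 1) * m with hL
  have hL0 : 0 ≤ L := by positivity
  set e₀ := ∫ ω : Fin N → EuclideanSpace ℝ (Fin n),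
    (sampleDeviation M ω ^ (2 * r)).trace ∂Measure.pi (fun _ => P) with he₀
  set e₁ := ∫ ω : Fin N → EuclideanSpace ℝ (Fin n),
    (sampleDeviation M ω ^ (2 * r + 1)).trace ∂Measure.pi (fun _ => P)
  set e₂ := ∫ ω : Fin N → EuclideanSpace ℝ (Fin n),
    (sampleDeviation M ω ^ (2 * (r + 1))).trace ∂Measure.pi (fun _ => P)
  have he₀_nonneg : 0 ≤ e₀ :=
    integral_nonneg fun ω => (isHermitian_sampleDeviation hM ω).trace_pow_nonneg r
  have exchange : e₂ ≤ L * (e₁ + 2 * (N * ‖M‖) * e₀) := by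
    have hsum : e₂ = ∑ j, ∫ ω : Fin N → EuclideanSpace ℝ (Fin n),
        ((Matrix.vecMulVec (ω j).ofLp (ω j).ofLp - M) *
          sampleDeviation M ω ^ (2 * r + 1)).trace ∂Measure.pi (fun _ => P) := by
      rw [← integral_finsetSum _ fun j _ => integrable_pi_of_ae_mem_closedBall hP (by fun_prop)]
      refine integral_congr_ae (.of_forall fun ω => ?_)
      dsimp only
      rw [← Matrix.trace_sum, ← Finset.sum_mul, show 2 * (r + 1) = 2 * r + 1 + 1 by ring, pow_succ']
      rfl
    have hbound : ∑ j, ∫ ω : Fin N → EuclideanSpace ℝ (Fin n),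
        ((Matrix.vecMulVec (ω j).ofLp (ω j).ofLp + M) *
          sampleDeviation M ω ^ (2 * r)).trace ∂Measure.pi (fun _ => P) ≤
        e₁ + 2 * (N * ‖M‖) * e₀ := by
      rw [he₀, ← integral_const_mul,
        ← integral_add (integrable_pi_of_ae_mem_closedBall hP (by fun_prop))
          (integrable_pi_of_ae_mem_closedBall hP (by fun_prop)),
        ← integral_finsetSum _ fun j _ => integrable_pi_of_ae_mem_closedBall hP (by fun_prop)]
      refine integral_mono (integrable_pi_of_ae_mem_closedBall hP (by fun_prop))
        (integrable_pi_of_ae_mem_closedBall hP (by fun_prop)) fun ω => ?_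
      have hω := Matrix.trace_mul_pow_le hM.posSemidef_norm_smul_one_sub
        (isHermitian_sampleDeviation hM ω) r
      rw [Matrix.smul_mul, one_mul, Matrix.trace_smul, smul_eq_mul] at hω
      -- The part equal to the deviation raises the power to the odd moment `e₁`; the rest is
      -- bounded through `M ≤ ‖M‖ • 1`.
      have hadd : ∑ j, (Matrix.vecMulVec (ω j).ofLp (ω j).ofLp + M) =
          sampleDeviation M ω + (2 * N : ℝ) • M := by
        simp only [sampleDeviation, Finset.sum_add_distrib, Finset.sum_sub_distrib,
          Finset.sum_const, Finset.card_univ, Fintype.card_fin, two_mul, add_smul,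
          Nat.cast_smul_eq_nsmul]
        abel
      dsimp only
      rw [← Matrix.trace_sum, ← Finset.sum_mul, hadd, add_mul, ← pow_succ', Matrix.smul_mul,
        Matrix.trace_add, Matrix.trace_smul, smul_eq_mul]
      have hN : (0 : ℝ) ≤ 2 * N := by positivity
      nlinarith [mul_le_mul_of_nonneg_left hω hN]
    rw [hsum]
    refine le_trans (Finset.sum_le_sum fun j _ => integral_trace_sub_mul_pow_le hm hP j r) ?_
    rw [← Finset.mul_sum]
    exact mul_le_mul_of_nonneg_left hbound hL0
  have odd : 2 * L * e₁ ≤ e₂ + L ^ 2 * e₀ := by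
    rw [he₀, ← integral_const_mul, ← integral_const_mul,
      ← integral_add (integrable_pi_of_ae_mem_closedBall hP (by fun_prop))
        (integrable_pi_of_ae_mem_closedBall hP (by fun_prop))]
    exact integral_mono (integrable_pi_of_ae_mem_closedBall hP (by fun_prop))
      (integrable_pi_of_ae_mem_closedBall hP (by fun_prop)) fun ω =>
      (isHermitian_sampleDeviation hM ω).mul_trace_odd_pow_le L r
  -- By `odd`, `L * e₁` costs at most half of `e₂`, which moves to the left side.
  calc e₂ ≤ (L ^ 2 + 4 * L * (N * ‖M‖)) * e₀ := by linarith
    _ ≤ (K ^ 2 + 4 * K * (N * ‖M‖)) * e₀ := by gcongr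

/-- Bound for the even trace moments of the sample deviation. -/
theorem integral_trace_sampleDeviation_pow_le (hm : 0 ≤ m)
    (hP : ∀ᵐ x ∂P, x ∈ Metric.closedBall (0 : EuclideanSpace ℝ (Fin n)) (√m)) {p : ℕ} {K : ℝ}
    (hK : 2 * p * m ≤ K) :
    ∫ ω : Fin N → EuclideanSpace ℝ (Fin n),
        (sampleDeviation (secondMomentMatrix P) ω ^ (2 * p)).trace ∂Measure.pi (fun _ => P) ≤
      (K ^ 2 + 4 * K * (N * ‖secondMomentMatrix P‖)) ^ p * n := by
  have hK0 : 0 ≤ K := le_trans (by positivity) hK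
  suffices h : ∀ r ≤ p, ∫ ω : Fin N → EuclideanSpace ℝ (Fin n),
        (sampleDeviation (secondMomentMatrix P) ω ^ (2 * r)).trace ∂Measure.pi (fun _ => P) ≤
      (K ^ 2 + 4 * K * (N * ‖secondMomentMatrix P‖)) ^ r * n from h p le_rfl
  intro r
  induction r with
  | zero => simp
  | succ r ih =>
    intro hr
    have hrp : ((2 * r + 1 : ℕ) : ℝ) ≤ ((2 * p : ℕ) : ℝ) := Nat.cast_le.2 (by omega)
    push_cast at hrp
    refine (integral_trace_sampleDeviation_pow_succ_le hm hP r
      ((mul_le_mul_of_nonneg_right hrp hm).trans hK)).trans ?_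
    exact (mul_le_mul_of_nonneg_left (ih (by omega)) (by positivity)).trans_eq (by ring)

/-- Markov's inequality for the even moments of the norm of the sample deviation. -/
theorem measureReal_lt_norm_sampleDeviation_le (hn : n ≠ 0) (hm : 0 ≤ m)
    (hP : ∀ᵐ x ∂P, x ∈ Metric.closedBall (0 : EuclideanSpace ℝ (Fin n)) (√m)) {p : ℕ} {K s : ℝ}
    (hK : 2 * p * m ≤ K) (hs : 0 < s) :
    (Measure.pi fun _ : Fin N => P).real {ω | s < ‖sampleDeviation (secondMomentMatrix P) ω‖} ≤
      ((K ^ 2 + 4 * K * (N * ‖secondMomentMatrix P‖)) / s ^ 2) ^ p * n := by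
  have : Nonempty (Fin n) := Fin.pos_iff_nonempty.1 (Nat.pos_of_ne_zero hn)
  have hM : (secondMomentMatrix P).IsHermitian := isHermitian_secondMomentMatrix P
  have hS := continuous_sampleDeviation (N := N) (secondMomentMatrix P)
  have markov := mul_meas_ge_le_integral_of_nonneg (μ := Measure.pi fun _ : Fin N => P)
    (f := fun ω => (sampleDeviation (secondMomentMatrix P) ω ^ (2 * p)).trace)
    (.of_forall fun ω => (isHermitian_sampleDeviation hM ω).trace_pow_nonneg p)
    (integrable_pi_of_ae_mem_closedBall hP (by fun_prop)) (s ^ (2 * p))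
  have hsub : {ω : Fin N → EuclideanSpace ℝ (Fin n) |
      s < ‖sampleDeviation (secondMomentMatrix P) ω‖} ⊆
      {ω | s ^ (2 * p) ≤ (sampleDeviation (secondMomentMatrix P) ω ^ (2 * p)).trace} := fun ω hω =>
    (pow_le_pow_left₀ hs.le (le_of_lt hω) _).trans
      ((isHermitian_sampleDeviation hM ω).norm_pow_le_trace p)
  refine (measureReal_mono hsub).trans ?_
  rw [div_pow, ← pow_mul, div_mul_eq_mul_div, le_div_iff₀ (by positivity), mul_comm]
  exact markov.trans (integral_trace_sampleDeviation_pow_le hm hP hK)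

/-- A moment bound with order of magnitude `t² log n` gives the tail `n ^ (-t²)`. -/
theorem tail_le_rpow (hn : 2 ≤ n) {t q : ℝ} {p : ℕ} (ht : 1 ≤ t)
    (hp : 2 * t ^ 2 * Real.log n ≤ p) (hq0 : 0 ≤ q) (hq : q ≤ Real.exp (-1)) :
    q ^ p * n ≤ (n : ℝ) ^ (-(t ^ 2)) := by
  have hn0 : (0 : ℝ) < n := by positivity
  have hlog : 0 ≤ Real.log n := Real.log_natCast_nonneg n
  calc q ^ p * n ≤ Real.exp (-1) ^ p * n := by gcongr
    _ = Real.exp (-p + Real.log n) := by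
      rw [Real.exp_add, Real.exp_log hn0, ← Real.exp_nat_mul, mul_neg_one]
    -- One of the two copies of `t² log n` in `p` pays for the dimension factor `n`.
    _ ≤ Real.exp (Real.log n * -(t ^ 2)) := by
      refine Real.exp_le_exp.2 ?_
      nlinarith [mul_le_mul_of_nonneg_right (one_le_pow₀ ht : 1 ≤ t ^ 2) hlog]
    _ = (n : ℝ) ^ (-(t ^ 2)) := (Real.rpow_def_of_pos hn0 _).symm

theorem sampleCovarianceMatrix_sub (hN : N ≠ 0) (M : Matrix (Fin n) (Fin n) ℝ)
    (x : Fin N → EuclideanSpace ℝ (Fin n)) :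
    sampleCovarianceMatrix x - M = (N : ℝ)⁻¹ • sampleDeviation M x := by
  have hN' : (N : ℝ) ≠ 0 := Nat.cast_ne_zero.2 hN
  rw [sampleCovarianceMatrix, sampleDeviation, Finset.sum_sub_distrib, smul_sub, one_div,
    Finset.sum_const, Finset.card_univ, Fintype.card_fin, ← Nat.cast_smul_eq_nsmul ℝ, smul_smul,
    inv_mul_cancel₀ hN', one_smul]

theorem pos_of_secondMomentMatrix_ne_zero {P : Measure (EuclideanSpace ℝ (Fin n))} (hm : 0 ≤ m)
    (hP : ∀ᵐ x ∂P, x ∈ Metric.closedBall (0 : EuclideanSpace ℝ (Fin n)) (√m))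
    (h : secondMomentMatrix P ≠ 0) : 0 < m := by
  refine lt_of_le_of_ne hm fun h0 => h ?_
  ext j k
  refine integral_eq_zero_of_ae ?_
  filter_upwards [hP] with x hx
  have : x = 0 := by simpa [← h0] using hx
  simp [this]

theorem measureReal_sampleCovarianceMatrix_gt_le (hn : 2 ≤ n) {ε t : ℝ} (hm : 0 ≤ m)
    (hP : ∀ᵐ x ∂P, x ∈ Metric.closedBall (0 : EuclideanSpace ℝ (Fin n)) (√m))
    (hM : secondMomentMatrix P ≠ 0) (hε : 0 < ε) (hε1 : ε < 1) (ht : 1 ≤ t)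
    (hN : 128 * (t / ε) ^ 2 * ‖secondMomentMatrix P‖⁻¹ * m * Real.log n ≤ N) :
    (Measure.pi fun _ : Fin N => P).real
        {ω | ε * ‖secondMomentMatrix P‖ < ‖sampleCovarianceMatrix ω - secondMomentMatrix P‖} ≤
      (n : ℝ) ^ (-(t ^ 2)) := by
  have hm0 := pos_of_secondMomentMatrix_ne_zero hm hP hM
  have hσ : 0 < ‖secondMomentMatrix P‖ := norm_pos_iff.2 hM
  have hlog2 : Real.log 2 ≤ Real.log n :=
    Real.log_le_log (by norm_num) (by exact_mod_cast hn)
  have hlog : 1 / 2 < Real.log n := lt_of_lt_of_le (by linarith [Real.log_two_gt_d9]) hlog2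
  have hlog0 : 0 < Real.log n := by linarith
  have hN0 : (0 : ℝ) < N := lt_of_lt_of_le (by positivity) hN
  have hN' : N ≠ 0 := by rintro rfl; simp at hN0
  set σ := ‖secondMomentMatrix P‖ with hσdef
  set p := ⌈2 * t ^ 2 * Real.log n⌉₊ with hp
  set a := t ^ 2 * Real.log n with ha
  -- This absorbs the rounding in `p`: `2a + 1 ≤ 4a`.
  have ha1 : 1 / 2 < a := by nlinarith [one_le_pow₀ ht (n := 2)]
  have hpa : (p : ℝ) ≤ 4 * a := by
    have := Nat.ceil_lt_add_one (a := 2 * t ^ 2 * Real.log n) (by positivity)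
    rw [← hp] at this
    linarith
  set s := N * (ε * σ) with hs
  have hs0 : 0 < s := by positivity
  have hma : 128 * a * m ≤ ε ^ 2 * (N * σ) := by
    have : 128 * (t / ε) ^ 2 * σ⁻¹ * m * Real.log n = 128 * a * m / (ε ^ 2 * σ) := by
      rw [ha]; field_simp
    rw [this, div_le_iff₀ (by positivity)] at hN
    linarith
  -- Here `2pm ≤ 8am`, and 128 = 8 · 16.
  have hK : 2 * p * m ≤ ε ^ 2 * (N * σ) / 16 := by
    have := mul_le_mul_of_nonneg_right hpa hm
    linarith
  have hset : {ω : Fin N → EuclideanSpace ℝ (Fin n) |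
      ε * σ < ‖sampleCovarianceMatrix ω - secondMomentMatrix P‖} =
      {ω | s < ‖sampleDeviation (secondMomentMatrix P) ω‖} := by
    ext ω
    rw [Set.mem_ofPred_eq, Set.mem_ofPred_eq, sampleCovarianceMatrix_sub hN', norm_smul,
      Real.norm_of_nonneg (by positivity), lt_inv_mul_iff₀ hN0]
  rw [hset]
  refine (measureReal_lt_norm_sampleDeviation_le (by omega) hm hP hK hs0).trans
    (tail_le_rpow hn ht (Nat.le_ceil _) (by positivity) ?_)
  -- With `K = ε² N σ / 16`, the ratio `(K² + 4 K N σ) / s²` is at most `1/256 + 1/4 < 1/3`.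
  have hexp : (1 : ℝ) / 3 ≤ Real.exp (-1) := by
    rw [Real.exp_neg, one_div]
    exact inv_anti₀ (Real.exp_pos 1) (by linarith [Real.exp_one_lt_d9])
  refine le_trans ?_ hexp
  rw [← hσdef, div_le_iff₀ (by positivity), hs]
  have hε2 : ε ^ 2 ≤ 1 := pow_le_one₀ hε.le hε1.le
  have h1 : 0 ≤ ε ^ 2 * (N * σ) ^ 2 := by positivity
  nlinarith [mul_le_mul_of_nonneg_right hε2 h1]

end Moments

/-- The norm of matrices is the operator norm from `ℓ²` to `ℓ²`. -/
theorem mainTheorem12 :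
    ∃ C : ℝ, 0 < C ∧
      ∀ (n : ℕ) (P : Measure (EuclideanSpace ℝ (Fin n))) [IsProbabilityMeasure P] (m ε t : ℝ),
        0 ≤ m →
        (∀ᵐ x ∂P, x ∈ Metric.closedBall (0 : EuclideanSpace ℝ (Fin n)) (√m)) →
        secondMomentMatrix P ≠ 0 →
        0 < ε → ε < 1 → 1 ≤ t →
        ∀ N : ℕ,
          C * (t / ε) ^ 2 * ‖secondMomentMatrix P‖⁻¹ * m * Real.log n ≤ (N : ℝ) →
          ∀ (Ω : Type*) [MeasurableSpace Ω] (μ : Measure Ω) [IsProbabilityMeasure μ]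
            (X : Fin N → Ω → EuclideanSpace ℝ (Fin n)),
            (∀ i, HasLaw (X i) P μ) → iIndepFun X μ →
            1 - (n : ℝ) ^ (-(t ^ 2)) ≤
              μ.real {ω | ‖sampleCovarianceMatrix (fun i => X i ω) - secondMomentMatrix P‖
                ≤ ε * ‖secondMomentMatrix P‖} := by
  refine ⟨128, by norm_num, ?_⟩
  intro n P _ m ε t hm hP hM hε hε1 ht N hN Ω _ μ _ X hX hind
  obtain rfl | rfl | hn : n = 0 ∨ n = 1 ∨ 2 ≤ n := by omega
  · exact absurd (Subsingleton.elim _ _) hM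
  -- For `n = 1` the asserted lower bound is `0`.
  · simp
  have hmeas : ∀ i, AEMeasurable (X i) μ := fun i => (hX i).aemeasurable
  have hlaw : μ.map (fun ω i => X i ω) = Measure.pi fun _ => P := by
    rw [(iIndepFun_iff_map_fun_eq_pi_map hmeas).1 hind]
    simp only [(hX _).map_eq]
  set G : Set (Fin N → EuclideanSpace ℝ (Fin n)) :=
    {x | ‖sampleCovarianceMatrix x - secondMomentMatrix P‖ ≤ ε * ‖secondMomentMatrix P‖} with hG
  have hcont : Continuous (sampleCovarianceMatrix (n := n) (N := N)) := by
    unfold sampleCovarianceMatrix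
    fun_prop
  have hGm : MeasurableSet G := (isClosed_le (by fun_prop) continuous_const).measurableSet
  have hbad := measureReal_sampleCovarianceMatrix_gt_le hn hm hP hM hε hε1 ht hN
  have hcompl : {x : Fin N → EuclideanSpace ℝ (Fin n) |
      ε * ‖secondMomentMatrix P‖ < ‖sampleCovarianceMatrix x - secondMomentMatrix P‖} = Gᶜ := by
    ext x
    simp [hG]
  rw [hcompl, probReal_compl_eq_one_sub hGm] at hbad
  have hpre : (Measure.pi fun _ : Fin N => P).real G = μ.real {ω | (fun i => X i ω) ∈ G} := by
    rw [← hlaw, map_measureReal_apply_of_aemeasurable (aemeasurable_pi_iff.2 hmeas) hGm]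
    rfl
  rw [hpre] at hbad
  exact sub_le_comm.1 hbad
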